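/- Let $\mathbb{F}_q$ be the finite field with $q$ elements. For a nonzero linear code $\mathcal{C}\subseteq\mathbb{F}_q^n$ of dimension $k$ and minimum Hamming distance $d$, let $S(\mathcal{C})=n-k-d+1$ be its Singleton defect, and let $\mathcal{C}^\perp=\{y\in\mathbb{F}_q^n : \sum_{i=1}^n x_iy_i=0 \text{ for all } x\in\mathcal{C}\}$ be its Euclidean dual. Call $\mathcal{C}$ an $\ell$-MDS $[n,k]_q$ code if $\mathcal{C}$ and $\mathcal{C}^\perp$ are both nonzero and $S(\mathcal{C})=S(\mathcal{C}^\perp)=\ell$. Let $A_i$ and $A_i^\perp$ be the numbers of codewords of Hamming weight $i$ in $\mathcal{C}$ and in $\mathcal{C}^\perp$, respectively. **Theorem.** Let $\mathcal{C}$ be an $\ell$-MDS $[n,k]_q$ code with $\ell\ge 1$. If $s\in\{0,1,\dots,k-\ell\}$, then $$A_{n-k+\ell+s}=\binom{n}{k-\ell-s}\sum_{j=0}^{s}(-1)^j\binom{n-k+\ell+s}{j}\left(q^{\ell+s-j}-1\right)+\sum_{i=n-k-\ell+1}^{n-k+\ell-1}(-1)^{s+1}\binom{n-i}{k-\ell-s}\binom{n-i-k+\ell+s-1}{s}A_i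 .$$ If $s\in\{0,1,\dots,n-k-\ell\}$, then $$A^{\perp}_{k+\ell+s}=\binom{n}{k+\ell+s}\sum_{j=0}^{s}(-1)^j\binom{k+\ell+s}{j}\left(q^{\ell+s-j}-1\right)+\sum_{i=k-\ell+1}^{k+\ell-1}(-1)^{s+1}\binom{n-i}{k+\ell+s-i}\binom{k+\ell+s-i-1}{s}A^{\perp}_i .$$ -/

import Mathlib

namespace LinearCode

variable {F : Type*} [Field F] {n : ℕ}

/-- The Euclidean dual code `C^⊥ = {y | ∑ i, x i * y i = 0 for all x ∈ C}`. -/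
def dual (C : Submodule F (Fin n → F)) : Submodule F (Fin n → F) :=
  C.orthogonalBilin (dotProductBilin F F)

theorem mem_dual {C : Submodule F (Fin n → F)} {y : Fin n → F} :
    y ∈ dual C ↔ ∀ x ∈ C, ∑ i, x i * y i = 0 :=
  Iff.rfl

variable [DecidableEq F]

/-- `A_i`: the number of codewords of Hamming weight `i`. -/
noncomputable def weightCount (C : Submodule F (Fin n → F)) (i : ℕ) : ℕ :=
  Set.ncard {c : Fin n → F | c ∈ C ∧ hammingNorm c = i}

/-- The minimum Hamming distance between distinct codewords (only meaningful for `C ≠ ⊥`). -/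
noncomputable def minDist (C : Submodule F (Fin n → F)) : ℕ :=
  sInf {d : ℕ | ∃ x ∈ C, ∃ y ∈ C, x ≠ y ∧ hammingDist x y = d}

/-- The Singleton defect `n - k - d + 1`, computed in `ℤ` so that nothing truncates. -/
noncomputable def singletonDefect (C : Submodule F (Fin n → F)) : ℤ :=
  (n : ℤ) - (Module.finrank F C : ℤ) - (minDist C : ℤ) + 1

/-- `C` is `ℓ`-MDS: `C` and its dual both have Singleton defect `ℓ`.  Both codes are required to be
nonzero, so that their minimum distances exist. -/
structure IsMDS (ℓ : ℕ) (C : Submodule F (Fin n → F)) : Prop where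
  ne_bot : C ≠ ⊥
  dual_ne_bot : dual C ≠ ⊥
  defect_eq : singletonDefect C = ℓ
  dual_defect_eq : singletonDefect (dual C) = ℓ

end LinearCode

namespace LinearCode

variable {F : Type*} [Field F] {n : ℕ}

/-! Fewer than `d(C^⊥)` coordinates are independent on `C`, so exactly `q^(k-m)` codewords vanish on
any `m` of them. Double counting then gives the binomial moments of the weights for `m ≤ k - ℓ`,
since `d(C^⊥) = k - ℓ + 1`. For `w = n - k + ℓ + s`, an alternating combination of the moments from
`n - w` to `k - ℓ` isolates `A_w`: for `i < w`, `A_i` is left with a factor `(-1)^s * (w-i-1).choose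
s`, zero once `i ≥ n - k + ℓ`, while `A_i = 0` for `0 < i < d = n - k - ℓ + 1`. The dual formula
follows since `C^⊥` is again `ℓ`-MDS. -/

theorem dotProductBilin_isRefl : LinearMap.BilinForm.IsRefl (dotProductBilin F F (m := Fin n) (A := F)) :=
  fun x y h => by
    change x ⬝ᵥ y = 0 at h
    change y ⬝ᵥ x = 0
    rwa [dotProduct_comm]

theorem dotProductBilin_nondegenerate :
    LinearMap.BilinForm.Nondegenerate (dotProductBilin F F (m := Fin n) (A := F)) := by
  refine ⟨fun x h => dotProduct_eq_zero_iff.mp h, fun y h => dotProduct_eq_zero_iff.mp fun w => ?_⟩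
  rw [dotProduct_comm]
  exact h w

theorem finrank_dual (C : Submodule F (Fin n → F)) :
    Module.finrank F (dual C) = n - Module.finrank F C := by
  have h := LinearMap.BilinForm.finrank_orthogonal dotProductBilin_nondegenerate C
  rwa [Module.finrank_fin_fun] at h

theorem dual_dual (C : Submodule F (Fin n → F)) : dual (dual C) = C :=
  LinearMap.BilinForm.orthogonal_orthogonal dotProductBilin_nondegenerate dotProductBilin_isRefl C

/-- Restriction of the codewords of `C` to the coordinates in `J`. -/
def restrictCoords (C : Submodule F (Fin n → F)) (J : Finset (Fin n)) : C →ₗ[F] (J → F) :=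
  (LinearMap.funLeft F F (Subtype.val : J → Fin n)).comp C.subtype

theorem restrictCoords_apply (C : Submodule F (Fin n → F)) (J : Finset (Fin n)) (c : C) (j : J) :
    restrictCoords C J c j = (c : Fin n → F) j := rfl

variable [DecidableEq F]

theorem IsMDS.isMDS_dual {ℓ : ℕ} {C : Submodule F (Fin n → F)} (hC : IsMDS ℓ C) :
    IsMDS ℓ (dual C) where
  ne_bot := hC.dual_ne_bot
  dual_ne_bot := by rw [dual_dual]; exact hC.ne_bot
  defect_eq := hC.dual_defect_eq
  dual_defect_eq := by rw [dual_dual]; exact hC.defect_eq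

theorem minDist_le_hammingNorm {C : Submodule F (Fin n → F)} {c : Fin n → F} (hc : c ∈ C)
    (h0 : c ≠ 0) : minDist C ≤ hammingNorm c :=
  Nat.sInf_le ⟨c, hc, 0, C.zero_mem, h0, hammingDist_zero_right c⟩

theorem minDist_pos {C : Submodule F (Fin n → F)} (hC : C ≠ ⊥) : 0 < minDist C := by
  obtain ⟨c, hc, h0⟩ := C.ne_bot_iff.mp hC
  have hne : {d : ℕ | ∃ x ∈ C, ∃ y ∈ C, x ≠ y ∧ hammingDist x y = d}.Nonempty :=
    ⟨_, c, hc, 0, C.zero_mem, h0, rfl⟩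
  obtain ⟨x, -, y, -, hxy, h⟩ := Nat.sInf_mem hne
  rw [minDist, ← h]
  exact hammingDist_pos.mpr hxy

theorem weightCount_zero (C : Submodule F (Fin n → F)) : weightCount C 0 = 1 := by
  have : {c : Fin n → F | c ∈ C ∧ hammingNorm c = 0} = {0} := by
    ext c
    simp only [hammingNorm_eq_zero, Set.mem_ofPred_eq, Set.mem_singleton_iff]
    exact ⟨And.right, fun h => ⟨h ▸ C.zero_mem, h⟩⟩
  rw [weightCount, this, Set.ncard_singleton]

theorem weightCount_eq_zero {C : Submodule F (Fin n → F)} {i : ℕ} (hi : i ≠ 0)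
    (h : i < minDist C) : weightCount C i = 0 := by
  have : {c : Fin n → F | c ∈ C ∧ hammingNorm c = i} = ∅ := by
    refine Set.eq_empty_of_forall_notMem ?_
    rintro c ⟨hc, rfl⟩
    exact (minDist_le_hammingNorm hc (hammingNorm_ne_zero_iff.mp hi)).not_gt h
  rw [weightCount, this, Set.ncard_empty]

/-- A proper image would be killed by a nonzero functional on `J → F`; its coefficients, extended by
zero, form a nonzero dual codeword of weight at most `J.card`. -/
theorem restrictCoords_surjective {C : Submodule F (Fin n → F)} {J : Finset (Fin n)}
    (hJ : J.card < minDist (dual C)) : Function.Surjective (restrictCoords C J) := by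
  rw [← LinearMap.range_eq_top]
  by_contra hne
  obtain ⟨f, hf, hle⟩ := Submodule.exists_le_ker_of_lt_top _ (lt_top_iff_ne_top.mpr hne)
  have hf_apply (v : J → F) : f v = ∑ j, v j * f (Pi.single j 1) := by
    conv_lhs => rw [pi_eq_sum_univ' v]
    rw [map_sum]
    simp only [map_smul, smul_eq_mul]
  set y : Fin n → F := fun i => if h : i ∈ J then f (Pi.single ⟨i, h⟩ 1) else 0 with hy
  have hsum (x : Fin n → F) : ∑ i, x i * y i = f (fun j => x j) := by
    rw [hf_apply, ← Finset.sum_subset (Finset.subset_univ J), ← Finset.sum_coe_sort]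
    · simp [hy]
    · intro i _ hi
      simp [hy, hi]
  have hyC : y ∈ dual C := mem_dual.mpr fun x hx => by
    rw [hsum]
    exact hle ⟨⟨x, hx⟩, rfl⟩
  have hy0 : y ≠ 0 := fun h0 => hf <| LinearMap.ext fun v => by
    rw [hf_apply, LinearMap.zero_apply]
    refine Finset.sum_eq_zero fun j _ => ?_
    have := congrFun h0 j
    simp only [hy, Finset.coe_mem, dite_true, Pi.zero_apply] at this
    rw [this, mul_zero]
  refine (hJ.trans_le (minDist_le_hammingNorm hyC hy0)).not_ge (Finset.card_le_card fun i hi => ?_)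
  by_contra hiJ
  simp [hy, hiJ] at hi

theorem weightCount_eq_card (C : Submodule F (Fin n → F)) [Fintype C] (i : ℕ) :
    weightCount C i = Finset.card {c : C | hammingNorm (c : Fin n → F) = i} := by
  rw [weightCount, ← Finset.card_map (Function.Embedding.subtype _), ← Set.ncard_coe_finset]
  congr 1
  ext c
  simp [and_comm]

variable [Fintype F]

/-- These codewords form the kernel of `restrictCoords C J`; rank-nullity gives its dimension. -/
theorem card_filter_forall_eq_zero {C : Submodule F (Fin n → F)} {J : Finset (Fin n)}
    [Fintype C] (hJ : J.card < minDist (dual C)) :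
    Finset.card {c : C | ∀ j ∈ J, (c : Fin n → F) j = 0} =
      Fintype.card F ^ (Module.finrank F C - J.card) := by
  have hrank := LinearMap.finrank_range_add_finrank_ker (restrictCoords C J)
  rw [LinearMap.range_eq_top.mpr (restrictCoords_surjective hJ), finrank_top,
    Module.finrank_fintype_fun_eq_card, Fintype.card_coe] at hrank
  have hcard := Module.natCard_eq_pow_finrank (K := F) (V := LinearMap.ker (restrictCoords C J))
  rw [Nat.card_eq_fintype_card (α := F)] at hcard
  rw [← hrank, Nat.add_sub_cancel_left, ← hcard, eq_comm]
  refine Nat.subtype_card _ fun c => ?_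
  simp [funext_iff, restrictCoords_apply]

/-- The binomial moments of the weight distribution count the codewords that vanish on the
coordinate sets of a given size. -/
theorem sum_weightCount_mul_choose {C : Submodule F (Fin n → F)} {m : ℕ}
    (hm : m < minDist (dual C)) :
    ∑ i ∈ Finset.range (n + 1), weightCount C i * (n - i).choose m =
      n.choose m * Fintype.card F ^ (Module.finrank F C - m) := by
  classical
  have : Fintype C := Fintype.ofFinite C
  have hzeros (c : C) :
      Finset.card {J ∈ Finset.powersetCard m (Finset.univ : Finset (Fin n)) |
        ∀ j ∈ J, (c : Fin n → F) j = 0} = (n - hammingNorm (c : Fin n → F)).choose m := by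
    have hz : Finset.card {j | (c : Fin n → F) j = 0} = n - hammingNorm (c : Fin n → F) := by
      have := Finset.card_filter_add_card_filter_not (s := Finset.univ)
        (fun j => (c : Fin n → F) j = 0)
      rw [Finset.card_fin] at this
      exact Nat.eq_sub_of_add_eq this
    rw [← hz, ← Finset.card_powersetCard]
    congr 1
    ext J
    simp [Finset.mem_powersetCard, Finset.subset_iff, and_comm]
  calc ∑ i ∈ Finset.range (n + 1), weightCount C i * (n - i).choose m
      = ∑ c : C, (n - hammingNorm (c : Fin n → F)).choose m := by
        rw [← Finset.sum_fiberwise_of_maps_to (s := Finset.univ) (t := Finset.range (n + 1))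
          (g := fun c : C => hammingNorm (c : Fin n → F))]
        · refine Finset.sum_congr rfl fun i _ => ?_
          rw [weightCount_eq_card, ← smul_eq_mul, ← Finset.sum_const]
          refine Finset.sum_congr rfl fun c hc => ?_
          rw [(Finset.mem_filter.mp hc).2]
        · intro c _
          have := hammingNorm_le_card_fintype (x := (c : Fin n → F))
          rw [Fintype.card_fin] at this
          exact Finset.mem_range_succ_iff.mpr this
    _ = ∑ J ∈ Finset.powersetCard m (Finset.univ : Finset (Fin n)),
          Finset.card {c : C | ∀ j ∈ J, (c : Fin n → F) j = 0} := by
        simp_rw [← hzeros]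
        exact Finset.sum_card_bipartiteAbove_eq_sum_card_bipartiteBelow
          (fun (c : C) (J : Finset (Fin n)) => ∀ j ∈ J, (c : Fin n → F) j = 0)
    _ = _ := by
        rw [Finset.sum_congr rfl fun J hJ => ?_, Finset.sum_const, Finset.card_powersetCard,
          Finset.card_fin, smul_eq_mul]
        have := (Finset.mem_powersetCard.mp hJ).2
        rw [card_filter_forall_eq_zero (this ▸ hm), this]

end LinearCode

/-- Truncated binomial inversion of moments: if the moments `∑ i, A i * (n - i).choose m` are known
for `n - w ≤ m ≤ n - w + s`, then they give the alternating sum on the left. -/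
theorem sum_mul_choose_mul_alternating_sum_choose {n w s : ℕ} (hw : w ≤ n)
    (A b : ℕ → ℤ)
    (hA : ∀ j ≤ s, ∑ i ∈ Finset.range (n + 1), A i * ((n - i).choose (n - w + j) : ℤ) =
      n.choose (n - w + j) * b j) :
    ∑ i ∈ Finset.range (w + 1), A i * ((n - i).choose (n - w) : ℤ) *
        ∑ j ∈ Finset.range (s + 1), (-1 : ℤ) ^ j * ((w - i).choose j : ℤ) =
      n.choose (n - w) * ∑ j ∈ Finset.range (s + 1), (-1 : ℤ) ^ j * (w.choose j : ℤ) * b j := by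
  -- This trades `(w - i).choose j` for a factor free of `i`, so the sum over `i` becomes a moment.
  have key (i j : ℕ) (hi : i ≤ w) : ((n - i).choose (n - w) : ℤ) * ((w - i).choose j : ℤ) =
      ((n - i).choose (n - w + j) : ℤ) * ((n - w + j).choose (n - w) : ℤ) := by
    have := Nat.choose_mul (n := n - i) (k := n - w + j) (s := n - w) (by omega)
    rw [show n - i - (n - w) = w - i by omega, Nat.add_sub_cancel_left] at this
    exact_mod_cast this.symm
  have hcut (j : ℕ) : ∑ i ∈ Finset.range (n + 1), A i * ((n - i).choose (n - w + j) : ℤ) =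
      ∑ i ∈ Finset.range (w + 1), A i * ((n - i).choose (n - w + j) : ℤ) := by
    refine (Finset.sum_subset (Finset.range_mono (by omega)) fun i hi hi' => ?_).symm
    rw [Finset.mem_range] at hi hi'
    rw [Nat.choose_eq_zero_of_lt (by omega), Nat.cast_zero, mul_zero]
  simp_rw [Finset.mul_sum]
  rw [Finset.sum_comm]
  refine Finset.sum_congr rfl fun j hj => ?_
  have h0 := key 0 j (Nat.zero_le w)
  have hj' := (hcut j).symm.trans (hA j (Finset.mem_range_succ_iff.mp hj))
  simp only [Nat.sub_zero] at h0
  calc _ = (-1 : ℤ) ^ j * ((n - w + j).choose (n - w) : ℤ) *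
        ∑ i ∈ Finset.range (w + 1), A i * ((n - i).choose (n - w + j) : ℤ) := by
        rw [Finset.mul_sum]
        refine Finset.sum_congr rfl fun i hi => ?_
        linear_combination A i * (-1) ^ j * key i j (Finset.mem_range_succ_iff.mp hi)
    _ = _ := by
        rw [hj']
        linear_combination -(-1) ^ j * b j * h0

namespace LinearCode

variable {F : Type*} [Field F] {n : ℕ} [DecidableEq F] [Fintype F]

theorem IsMDS.weightCount_eq {q k ℓ : ℕ} (hq : Fintype.card F = q) (hℓ : 1 ≤ ℓ)
    {C : Submodule F (Fin n → F)} (hk : Module.finrank F C = k) (hC : IsMDS ℓ C) {s : ℕ}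
    (hs : s + ℓ ≤ k) :
    (weightCount C (n - k + ℓ + s) : ℤ) =
      (n.choose (k - ℓ - s) : ℤ) *
          ∑ j ∈ Finset.range (s + 1),
            (-1 : ℤ) ^ j * ((n - k + ℓ + s).choose j : ℤ) * ((q : ℤ) ^ (ℓ + s - j) - 1) +
        ∑ i ∈ Finset.Icc (n - k - ℓ + 1) (n - k + ℓ - 1),
          (-1 : ℤ) ^ (s + 1) * ((n - i).choose (k - ℓ - s) : ℤ) *
            ((n - k + ℓ + s - i - 1).choose s : ℤ) * (weightCount C i : ℤ) := by
  have hkn : k ≤ n := by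
    simpa [hk] using Submodule.finrank_le C
  have hd : n + 1 = k + ℓ + minDist C := by
    have := hC.defect_eq
    rw [singletonDefect, hk] at this
    omega
  have hd' : k + 1 = ℓ + minDist (dual C) := by
    have := hC.dual_defect_eq
    rw [singletonDefect, finrank_dual, hk] at this
    omega
  -- With `hd` this yields `k + ℓ ≤ n`, so `n - k - ℓ` does not truncate.
  have hpos := minDist_pos hC.ne_bot
  obtain ⟨w, hw⟩ : ∃ w, w = n - k + ℓ + s := ⟨_, rfl⟩
  rw [show k - ℓ - s = n - w by omega, ← hw]
  have hmain := sum_mul_choose_mul_alternating_sum_choose (n := n) (w := w) (s := s) (by omega)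
    -- Dropping the zero codeword removes `n.choose m` from each moment, whence the `- 1`.
    (fun i => if i = 0 then 0 else (weightCount C i : ℤ))
    (fun j => (q : ℤ) ^ (ℓ + s - j) - 1) fun j hj => by
      have h := sum_weightCount_mul_choose (C := C) (m := n - w + j) (by omega)
      rw [hq, hk, show k - (n - w + j) = ℓ + s - j by omega, Finset.sum_range_succ',
        weightCount_zero] at h
      have h' := congrArg (Nat.cast : ℕ → ℤ) h
      push_cast at h'
      rw [Finset.sum_range_succ']
      simp only [Nat.add_eq_zero_iff, one_ne_zero, and_false, if_false, if_true, zero_mul,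
        add_zero]
      simp only [Nat.sub_zero, one_mul] at h'
      linear_combination h'
  rw [Finset.sum_range_succ, if_neg (by omega), Nat.choose_self, Nat.sub_self,
    Finset.sum_range_succ' _ s] at hmain
  simp only [Nat.choose_zero_succ, Nat.cast_zero, mul_zero, Finset.sum_const_zero, zero_add,
    pow_zero, Nat.choose_zero_right, Nat.cast_one, mul_one] at hmain
  rw [← hmain, ← Finset.sum_subset (s₁ := Finset.Icc (n - k - ℓ + 1) (n - k + ℓ - 1)),
    add_right_comm, ← Finset.sum_add_distrib, Finset.sum_eq_zero, zero_add]
  · intro i hi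
    rw [Finset.mem_Icc] at hi
    obtain ⟨r, hr⟩ : ∃ r, w - i = r + 1 := ⟨w - i - 1, by omega⟩
    rw [hr, Int.alternating_sum_range_choose_eq_choose, Nat.add_sub_cancel, if_neg (by omega)]
    ring
  · intro i hi
    rw [Finset.mem_Icc] at hi
    rw [Finset.mem_range]
    omega
  · intro i hi hi'
    rw [Finset.mem_Icc] at hi'
    rw [Finset.mem_range] at hi
    rcases Nat.eq_zero_or_pos i with h0 | h0
    · rw [if_pos h0, zero_mul, zero_mul]
    rw [if_neg h0.ne']
    rcases Nat.lt_or_ge i (minDist C) with h | h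
    · rw [weightCount_eq_zero h0.ne' h, Nat.cast_zero, zero_mul, zero_mul]
    -- Here `n - k + ℓ ≤ i < w`, so `w - i - 1 < s`.
    · obtain ⟨r, hr⟩ : ∃ r, w - i = r + 1 := ⟨w - i - 1, by omega⟩
      rw [hr, Int.alternating_sum_range_choose_eq_choose,
        Nat.choose_eq_zero_of_lt (show r < s by omega), Nat.cast_zero, mul_zero, mul_zero]

end LinearCode

theorem mainTheorem10 {F : Type*} [Field F] [Fintype F] [DecidableEq F] (q n k ℓ : ℕ)
    (hq : Fintype.card F = q) (hℓ : 1 ≤ ℓ) (C : Submodule F (Fin n → F))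
    (hk : Module.finrank F C = k) (hC : LinearCode.IsMDS ℓ C) :
    (∀ s : ℕ, s + ℓ ≤ k →
      (LinearCode.weightCount C (n - k + ℓ + s) : ℤ) =
        (n.choose (k - ℓ - s) : ℤ) *
            ∑ j ∈ Finset.range (s + 1),
              (-1 : ℤ) ^ j * ((n - k + ℓ + s).choose j : ℤ) * ((q : ℤ) ^ (ℓ + s - j) - 1) +
          ∑ i ∈ Finset.Icc (n - k - ℓ + 1) (n - k + ℓ - 1),
            (-1 : ℤ) ^ (s + 1) * ((n - i).choose (k - ℓ - s) : ℤ) *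
              ((n - k + ℓ + s - i - 1).choose s : ℤ) * (LinearCode.weightCount C i : ℤ)) ∧
    (∀ s : ℕ, s + k + ℓ ≤ n →
      (LinearCode.weightCount (LinearCode.dual C) (k + ℓ + s) : ℤ) =
        (n.choose (k + ℓ + s) : ℤ) *
            ∑ j ∈ Finset.range (s + 1),
              (-1 : ℤ) ^ j * ((k + ℓ + s).choose j : ℤ) * ((q : ℤ) ^ (ℓ + s - j) - 1) +
          ∑ i ∈ Finset.Icc (k - ℓ + 1) (k + ℓ - 1),
            (-1 : ℤ) ^ (s + 1) * ((n - i).choose (k + ℓ + s - i) : ℤ) *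
              ((k + ℓ + s - i - 1).choose s : ℤ) *
                (LinearCode.weightCount (LinearCode.dual C) i : ℤ)) := by
  have hkn : k ≤ n := by
    simpa [hk] using Submodule.finrank_le C
  refine ⟨fun s hs => hC.weightCount_eq hq hℓ hk hs, fun s hs => ?_⟩
  have h := hC.isMDS_dual.weightCount_eq hq hℓ (LinearCode.finrank_dual C) (s := s) (by omega)
  rw [hk, show n - (n - k) = k by omega] at h
  rw [h, ← Nat.choose_symm (show k + ℓ + s ≤ n by omega),
    show n - (k + ℓ + s) = n - k - ℓ - s by omega]
  congr 1
  refine Finset.sum_congr rfl fun i hi => ?_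
  rw [Finset.mem_Icc] at hi
  rw [← Nat.choose_symm (show k + ℓ + s - i ≤ n - i by omega),
    show n - i - (k + ℓ + s - i) = n - k - ℓ - s by omega]
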